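/- Let $N\ge 1$ and let $\mathcal G$ be the star graph on the vertex set $\{0,1,\dots,N-1\}$ with hub $0$ (the edges are exactly $\{0,j\}$, $1\le j\le N-1$), and let $L=D-A$ be its Laplacian matrix. Consider the noisy second-order consensus dynamics $$\begin{bmatrix}\dot x_1(t)\\ \dot x_2(t)\end{bmatrix}=\begin{bmatrix}0&I\\-L&-L\end{bmatrix}\begin{bmatrix}x_1(t)\\x_2(t)\end{bmatrix}+\begin{bmatrix}0\\I\end{bmatrix}w(t),\qquad t\ge 0,$$ where $w$ is an $N$-vector of independent unit-intensity Gaussian white noises; that is, $dx_1=x_2\,dt$ and $dx_2=(-Lx_1-Lx_2)\,dt+dW$ for a standard $N$-dimensional Brownian motion $W$. Let $(x_1,x_2)$ be any solution with continuous paths and square-integrable initial state $(x_1(0),x_2(0))$, and put $\bar x_1(t)=\frac1N\sum_{j=0}^{N-1}x_{1j}(t)$. Define the pairwise variance, the vertex variance and the total variance by $$H_{\mathrm{SO}}(j,k)=\lim_{t\to\infty}\mathbb E\big[(x_{1j}(t)-x_{1k}(t))^2\big],\qquad H_{\mathrm{SO}}(j)=\lim_{t\to\infty}\mathbb E\big[(x_{1j}(t)-\bar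 x_1(t))^2\big],\qquad H_{\mathrm{SO}}(\mathcal G)=\lim_{t\to\infty}\sum_{j=0}^{N-1}\mathbb E\big[(x_{1j}(t)-\bar x_1(t))^2\big].$$ Then all these expectations are finite, all these limits exist, and $$\begin{aligned} H_{\mathrm{SO}}(0,j)&=\frac{N-1}{2N}, && j\neq 0;\\ H_{\mathrm{SO}}(j,k)&=1, && j\neq k,\ j,k\neq 0;\\ H_{\mathrm{SO}}(0)&=\frac{N-1}{2N^3};\\ H_{\mathrm{SO}}(j)&=\frac{N^3-N^2-N-1}{2N^3}, && j\neq 0;\\ H_{\mathrm{SO}}(\mathcal G)&=\frac N2-1+\frac1{2N^2}. \end{aligned}$$ -/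

import Mathlib

open MeasureTheory ProbabilityTheory Filter Topology
open scoped NNReal

namespace SecondOrderConsensus

variable {Ω V : Type*} [MeasurableSpace Ω]

/-- A standard `V`-dimensional Brownian motion: independent standard real Brownian motions, one
for each `v : V`. Its formal time derivative is the vector of uncorrelated (unit intensity)
Gaussian white noises `w`. -/
structure IsStandardBrownian (W : V → ℝ≥0 → Ω → ℝ) (P : Measure Ω) : Prop where
  isBrownian : ∀ v, IsBrownianReal (W v) P
  indep : iIndepFun (fun (v : V) (ω : Ω) (t : ℝ≥0) ↦ W v t ω) P

/-- `(x₁, x₂)` is a solution, driven by the Brownian motion `W`, of the noisy second-order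
consensus dynamics on the graph `G` with Laplacian matrix `L`,
`dx₁ = x₂ dt`, `dx₂ = (- L x₁ - L x₂) dt + dW`,
with continuous paths and square-integrable initial state. Since the noise is additive, the
stochastic differential equation is an integral equation that holds path by path. -/
structure IsSolution [Fintype V] [DecidableEq V] (G : SimpleGraph V) [DecidableRel G.Adj]
    (W : V → ℝ≥0 → Ω → ℝ) (x₁ x₂ : ℝ≥0 → Ω → V → ℝ) (P : Measure Ω) : Prop where
  isStandardBrownian : IsStandardBrownian W P
  aemeasurable_fst : ∀ t, AEMeasurable (x₁ t) P
  aemeasurable_snd : ∀ t, AEMeasurable (x₂ t) P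
  memLp_init_fst : ∀ v, MemLp (fun ω ↦ x₁ 0 ω v) 2 P
  memLp_init_snd : ∀ v, MemLp (fun ω ↦ x₂ 0 ω v) 2 P
  continuous_fst : ∀ᵐ ω ∂P, Continuous fun t ↦ x₁ t ω
  continuous_snd : ∀ᵐ ω ∂P, Continuous fun t ↦ x₂ t ω
  eq_fst : ∀ᵐ ω ∂P, ∀ (t : ℝ≥0) (v : V),
    x₁ t ω v = x₁ 0 ω v + ∫ s in (0 : ℝ)..t, x₂ s.toNNReal ω v
  eq_snd : ∀ᵐ ω ∂P, ∀ (t : ℝ≥0) (v : V),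
    x₂ t ω v = x₂ 0 ω v
      + (∫ s in (0 : ℝ)..t,
          (-((G.lapMatrix ℝ).mulVec (x₁ s.toNNReal ω) v)
            - (G.lapMatrix ℝ).mulVec (x₂ s.toNNReal ω) v))
      + W v t ω

/-- The average `(1 / N) ∑ v, x v` of the entries of a vector, where `N` is the number of
vertices. -/
noncomputable def average [Fintype V] (x : V → ℝ) : ℝ :=
  (∑ v, x v) / Fintype.card V

/-- The pairwise variance of the vertices `j`, `k` exists and equals `h`: all second moments are
finite and `lim_{t → ∞} E[(x₁ⱼ(t) - x₁ₖ(t))²] = h`. -/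
def HasPairwiseVariance (x₁ : ℝ≥0 → Ω → V → ℝ) (P : Measure Ω) (j k : V) (h : ℝ) : Prop :=
  (∀ t, Integrable (fun ω ↦ (x₁ t ω j - x₁ t ω k) ^ 2) P) ∧
    Tendsto (fun t ↦ ∫ ω, (x₁ t ω j - x₁ t ω k) ^ 2 ∂P) atTop (𝓝 h)

/-- The vertex variance of the vertex `j` exists and equals `h`: all second moments are finite and
`lim_{t → ∞} E[(x₁ⱼ(t) - average (x₁(t)))²] = h`. -/
def HasVertexVariance [Fintype V] (x₁ : ℝ≥0 → Ω → V → ℝ) (P : Measure Ω) (j : V) (h : ℝ) : Prop :=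
  (∀ t, Integrable (fun ω ↦ (x₁ t ω j - average (x₁ t ω)) ^ 2) P) ∧
    Tendsto (fun t ↦ ∫ ω, (x₁ t ω j - average (x₁ t ω)) ^ 2 ∂P) atTop (𝓝 h)

/-- The total variance of the network exists and equals `h`: all second moments are finite and
`lim_{t → ∞} ∑ⱼ E[(x₁ⱼ(t) - average (x₁(t)))²] = h`. -/
def HasTotalVariance [Fintype V] (x₁ : ℝ≥0 → Ω → V → ℝ) (P : Measure Ω) (h : ℝ) : Prop :=
  (∀ j t, Integrable (fun ω ↦ (x₁ t ω j - average (x₁ t ω)) ^ 2) P) ∧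
    Tendsto (fun t ↦ ∑ j, ∫ ω, (x₁ t ω j - average (x₁ t ω)) ^ 2 ∂P) atTop (𝓝 h)

end SecondOrderConsensus

/-! Every quantity is a limiting second moment of `c ⬝ᵥ x₁ t` with `∑ v, c v = 0`, so the undamped
consensus mode drops out. Along a Laplacian eigenvector with eigenvalue `lam > 0` the system is a
scalar oscillator `y'' + lam y' + lam y = noise`, whose stationary variance per unit noise is `∫₀^∞
g² = 1 / (2 lam²)` for the impulse response `g` (`tendsto_integral_sq`).

No stochastic integral is needed: integrating by parts turns `∫ g(t - s) dW` into the pathwise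
integral `∫ g'(t - s) W(s) ds` (`eq_of_integral_eq`). Its variance comes from Fubini and the
covariance `min s r` (`memLp_sum_integral`), and the initial data decay
(`HasLimitSecondMoment.zero_add`).

On sum-zero vectors the star Laplacian has only the eigenvalues `N` and `1`. Splitting `c`
accordingly gives one formula for all variances (`hasLimitSecondMoment_starGraph`). -/

namespace SecondOrderConsensus

open scoped Matrix

/-! ### The damped oscillator -/

/-- `g` is the impulse response of the damped oscillator `y'' + lam y' + lam y = 0`, and `g'` is
its derivative. -/
structure IsImpulseResponse (lam : ℝ) (g g' : ℝ → ℝ) : Prop where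
  hasDerivAt : ∀ t, HasDerivAt g (g' t) t
  hasDerivAt_deriv : ∀ t, HasDerivAt g' (-(lam * g t) - lam * g' t) t
  zero : g 0 = 0
  deriv_zero : g' 0 = 1

theorem exists_isImpulseResponse (lam : ℝ) : ∃ g g' : ℝ → ℝ, IsImpulseResponse lam g g' := by
  let p : ℝ × ℝ →L[ℝ] ℝ := ContinuousLinearMap.fst ℝ ℝ ℝ
  let q : ℝ × ℝ →L[ℝ] ℝ := ContinuousLinearMap.snd ℝ ℝ ℝ
  let A : ℝ × ℝ →L[ℝ] ℝ × ℝ := q.prod (-(lam • p) - lam • q)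
  let u : ℝ → ℝ × ℝ := fun t ↦ NormedSpace.exp (t • A) (0, 1)
  have hu : ∀ t, HasDerivAt u (A (u t)) t := fun t ↦
    (hasDerivAt_exp_smul_const' A t).clm_apply (hasDerivAt_const t ((0, 1) : ℝ × ℝ)) |>.congr_deriv
      (by simp [u])
  have h0 : u 0 = (0, 1) := by simp [u]
  refine ⟨fun t ↦ (u t).1, fun t ↦ (u t).2, fun t ↦ ?_, fun t ↦ ?_, by simp [h0], by simp [h0]⟩
  · exact (p.hasFDerivAt.comp_hasDerivAt t (hu t)).congr_deriv (by simp [p, q, A])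
  · exact (q.hasFDerivAt.comp_hasDerivAt t (hu t)).congr_deriv (by simp [p, q, A])

namespace IsImpulseResponse

variable {lam : ℝ} {g g' : ℝ → ℝ}

theorem continuous (h : IsImpulseResponse lam g g') : Continuous g :=
  continuous_iff_continuousAt.2 fun t ↦ (h.hasDerivAt t).continuousAt

theorem continuous_deriv (h : IsImpulseResponse lam g g') : Continuous g' :=
  continuous_iff_continuousAt.2 fun t ↦ (h.hasDerivAt_deriv t).continuousAt

/-- The derivative of a quadratic form along the impulse response. -/
theorem hasDerivAt_quadratic (h : IsImpulseResponse lam g g') (a b c t : ℝ) :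
    HasDerivAt (fun t ↦ a * g t ^ 2 + b * (g t * g' t) + c * g' t ^ 2)
      (-(lam * b) * g t ^ 2 + (2 * a - lam * b - 2 * lam * c) * (g t * g' t)
        + (b - 2 * lam * c) * g' t ^ 2) t := by
  have h1 := h.hasDerivAt t
  have h2 := h.hasDerivAt_deriv t
  refine ((((h1.pow 2).const_mul a).add ((h1.mul h2).const_mul b)).add
    ((h2.pow 2).const_mul c)).congr_deriv ?_
  simp
  ring

/-- A quadratic Lyapunov function comparable to `g ^ 2 + g' ^ 2` decays exponentially, which avoids
separating the under- and overdamped cases. -/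
theorem tendsto_sq_add_sq (h : IsImpulseResponse lam g g') (hlam : 0 < lam) :
    Tendsto (fun t ↦ g t ^ 2 + g' t ^ 2) atTop (𝓝 0) := by
  -- `a`, `m`, `c` are the coefficients that solve `V' = -(g ^ 2 + g' ^ 2)`.
  set m := 1 / lam with hm
  have hm0 : 0 < m := by positivity
  have hlm : lam * m = 1 := by rw [hm]; field_simp
  set c := (1 + m) * m / 2 with hc
  set a := (2 + m) / 2 with ha
  have hd : ∀ t, HasDerivAt (fun t ↦ a * g t ^ 2 + m * (g t * g' t) + c * g' t ^ 2)
      (-(g t ^ 2 + g' t ^ 2)) t := fun t ↦ by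
    refine (h.hasDerivAt_quadratic a m c t).congr_deriv ?_
    have h3 : 2 * lam * c = 1 + m := by rw [hc]; linear_combination (1 + m) * hlm
    have h4 : 2 * a = 2 + m := by rw [ha]; ring
    rw [hlm, h3, h4]; ring
  set V := fun t ↦ a * g t ^ 2 + m * (g t * g' t) + c * g' t ^ 2 with hV
  set K := a + m + c with hK
  have hK0 : 0 < K := by positivity
  have hup : ∀ t, V t ≤ K * (g t ^ 2 + g' t ^ 2) := fun t ↦ by
    have h1 : 0 ≤ m * ((g t - g' t) ^ 2 + g t ^ 2 + g' t ^ 2) := by positivity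
    have h2 : 0 ≤ c * g t ^ 2 + a * g' t ^ 2 := by positivity
    simp only [hV, hK]
    nlinarith
  have hlow : ∀ t, g t ^ 2 / 2 + m / 4 * g' t ^ 2 ≤ V t := fun t ↦ by
    have h3 : V t - (g t ^ 2 / 2 + m / 4 * g' t ^ 2)
        = (1 / 2) * (g t + m * g' t) ^ 2 + m / 2 * (g t) ^ 2 + m / 4 * g' t ^ 2 := by
      simp only [hV, ha, hc]; ring
    rw [← sub_nonneg, h3]
    positivity
  -- Since `V ≤ K (g ^ 2 + g' ^ 2) = -K V'`, the product `V * exp (t / K)` is nonincreasing.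
  have hexp : ∀ t, HasDerivAt (fun t ↦ V t * Real.exp (t / K))
      (-(g t ^ 2 + g' t ^ 2) * Real.exp (t / K) + V t * (Real.exp (t / K) * (1 / K))) t := fun t ↦
    (hd t).mul (((hasDerivAt_id t).div_const K).exp)
  have hanti : Antitone (fun t ↦ V t * Real.exp (t / K)) := by
    refine antitone_of_deriv_nonpos (fun t ↦ (hexp t).differentiableAt) fun t ↦ ?_
    rw [(hexp t).deriv]
    have h1 : V t * (1 / K) ≤ g t ^ 2 + g' t ^ 2 := by
      rw [mul_one_div, div_le_iff₀ hK0]; linarith [hup t]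
    have := mul_le_mul_of_nonneg_right h1 (Real.exp_pos (t / K)).le
    linarith
  have hVb : ∀ t, 0 ≤ t → V t ≤ V 0 * Real.exp (-(t / K)) := fun t ht ↦ by
    have := hanti ht
    simp only [zero_div, Real.exp_zero, mul_one] at this
    rw [Real.exp_neg, ← div_eq_mul_inv, le_div_iff₀ (Real.exp_pos _)]
    exact this
  -- Multiplying `hlow` by `2 + 4 * lam` makes both of its coefficients at least `1`.
  have hlim : Tendsto (fun t ↦ (2 + 4 * lam) * (V 0 * Real.exp (-(t / K)))) atTop (𝓝 0) := by
    have : Tendsto (fun t : ℝ ↦ Real.exp (-(t / K))) atTop (𝓝 0) :=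
      Real.tendsto_exp_neg_atTop_nhds_zero.comp (tendsto_id.atTop_div_const hK0)
    simpa using (this.const_mul (V 0)).const_mul (2 + 4 * lam)
  refine squeeze_zero' (Eventually.of_forall fun t ↦ by positivity) ?_ hlim
  filter_upwards [eventually_ge_atTop 0] with t ht
  have h1 := (hlow t).trans (hVb t ht)
  have h2 := mul_le_mul_of_nonneg_left h1 (show 0 ≤ 2 + 4 * lam by positivity)
  have h3 : (2 + 4 * lam) * (g t ^ 2 / 2 + m / 4 * g' t ^ 2)
      = g t ^ 2 + g' t ^ 2 + 2 * lam * g t ^ 2 + m / 2 * g' t ^ 2 := by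
    linear_combination g' t ^ 2 * hlm
  have : 0 ≤ 2 * lam * g t ^ 2 + m / 2 * g' t ^ 2 := by positivity
  linarith

theorem tendsto_zero (h : IsImpulseResponse lam g g') (hlam : 0 < lam) :
    Tendsto g atTop (𝓝 0) := by
  rw [tendsto_zero_iff_abs_tendsto_zero]
  have h1 := (h.tendsto_sq_add_sq hlam).sqrt
  rw [Real.sqrt_zero] at h1
  exact squeeze_zero (fun t ↦ abs_nonneg _)
    (fun t ↦ Real.abs_le_sqrt (by nlinarith [sq_nonneg (g' t)])) h1

theorem tendsto_deriv_zero (h : IsImpulseResponse lam g g') (hlam : 0 < lam) :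
    Tendsto g' atTop (𝓝 0) := by
  rw [tendsto_zero_iff_abs_tendsto_zero]
  have h1 := (h.tendsto_sq_add_sq hlam).sqrt
  rw [Real.sqrt_zero] at h1
  exact squeeze_zero (fun t ↦ abs_nonneg _)
    (fun t ↦ Real.abs_le_sqrt (by nlinarith [sq_nonneg (g t)])) h1

/-- `g ^ 2` has an explicit primitive, minus a quadratic form in `g`, `g'`. The form vanishes at
infinity and equals the coefficient `c` of `g' ^ 2` at time `0`. -/
theorem tendsto_integral_sq (h : IsImpulseResponse lam g g') (hlam : 0 < lam) :
    Tendsto (fun t ↦ ∫ s in (0 : ℝ)..t, g s ^ 2) atTop (𝓝 (1 / (2 * lam ^ 2))) := by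
  set c := 1 / (2 * lam ^ 2) with hc
  set b := 1 / lam with hb
  set a := (1 + 1 / lam) / 2 with ha
  have hd : ∀ t, HasDerivAt (fun t ↦ -(a * g t ^ 2 + b * (g t * g' t) + c * g' t ^ 2))
      (g t ^ 2) t := fun t ↦ by
    refine (h.hasDerivAt_quadratic a b c t).neg.congr_deriv ?_
    rw [ha, hb, hc]; field_simp; ring
  have hint : ∀ t, ∫ s in (0 : ℝ)..t, g s ^ 2
      = c - (a * g t ^ 2 + b * (g t * g' t) + c * g' t ^ 2) := fun t ↦ by
    rw [intervalIntegral.integral_eq_sub_of_hasDerivAt (fun s _ ↦ hd s)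
      ((h.continuous.pow 2).intervalIntegrable _ _), h.zero, h.deriv_zero]
    ring
  simp_rw [hint]
  have h1 := h.tendsto_zero hlam
  have h2 := h.tendsto_deriv_zero hlam
  simpa using ((((h1.pow 2).const_mul a).add ((h1.mul h2).const_mul b)).add
    ((h2.pow 2).const_mul c)).const_sub c

/-- Variation of constants for `y' = z`, `z' = -lam y - lam z + b'`. -/
theorem eq_of_integral_eq (h : IsImpulseResponse lam g g') {y z b : ℝ≥0 → ℝ}
    (hy : Continuous y) (hz : Continuous z) (hb : Continuous b)
    (hyz : ∀ t : ℝ≥0, y t = y 0 + ∫ s in (0 : ℝ)..t, z s.toNNReal)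
    (hzb : ∀ t : ℝ≥0, z t = z 0 +
      (∫ s in (0 : ℝ)..t, (-(lam * y s.toNNReal) - lam * z s.toNNReal)) + b t) (t : ℝ≥0) :
    y t = (g' t + lam * g t) * y 0 + g t * z 0
      + ∫ s in (0 : ℝ)..t, g' (t - s) * b s.toNNReal := by
  have hcy : Continuous fun s : ℝ ↦ y s.toNNReal := hy.comp continuous_real_toNNReal
  have hcz : Continuous fun s : ℝ ↦ z s.toNNReal := hz.comp continuous_real_toNNReal
  have hcb : Continuous fun s : ℝ ↦ b s.toNNReal := hb.comp continuous_real_toNNReal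
  have hcw : Continuous fun s : ℝ ↦ -(lam * y s.toNNReal) - lam * z s.toNNReal := by fun_prop
  set Y : ℝ → ℝ := fun s ↦ y 0 + ∫ r in (0 : ℝ)..s, z r.toNNReal with hY
  -- `X` is `z` without the noise `b`; unlike `z` it is differentiable.
  set X : ℝ → ℝ := fun s ↦ z 0 + ∫ r in (0 : ℝ)..s, (-(lam * y r.toNNReal) - lam * z r.toNNReal)
    with hX
  have hYd : ∀ s, HasDerivAt Y (z s.toNNReal) s := fun s ↦
    (intervalIntegral.integral_hasDerivAt_right (hcz.intervalIntegrable _ _)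
      (hcz.stronglyMeasurableAtFilter _ _) hcz.continuousAt).const_add _
  have hXd : ∀ s, HasDerivAt X (-(lam * y s.toNNReal) - lam * z s.toNNReal) s := fun s ↦
    (intervalIntegral.integral_hasDerivAt_right (hcw.intervalIntegrable _ _)
      (hcw.stronglyMeasurableAtFilter _ _) hcw.continuousAt).const_add _
  have hYy : ∀ s : ℝ, 0 ≤ s → y s.toNNReal = Y s := fun s hs ↦ by
    rw [hyz, Real.coe_toNNReal s hs]
  have hXz : ∀ s : ℝ, 0 ≤ s → z s.toNNReal = X s + b s.toNNReal := fun s hs ↦ by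
    rw [hzb, Real.coe_toNNReal s hs]
  have hsub : ∀ s, HasDerivAt (fun s ↦ (t : ℝ) - s) (-1) s := fun s ↦ by
    simpa using (hasDerivAt_id s).const_sub (t : ℝ)
  have hg : ∀ s, HasDerivAt (fun s ↦ g (t - s)) (-g' (t - s)) s :=
    fun s ↦ ((h.hasDerivAt (t - s)).comp s (hsub s)).congr_deriv (by ring)
  have hg' : ∀ s, HasDerivAt (fun s ↦ g' (t - s)) (lam * g (t - s) + lam * g' (t - s)) s :=
    fun s ↦ ((h.hasDerivAt_deriv (t - s)).comp s (hsub s)).congr_deriv (by ring)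
  -- On `[0, t]` this derivative collapses to `g' (t - s) * (z - X) = g' (t - s) * b`.
  have hΦ : ∀ s, HasDerivAt
      (fun s ↦ (g' (t - s) + lam * g (t - s)) * Y s + g (t - s) * X s)
      ((lam * g (t - s) + lam * g' (t - s) + lam * -g' (t - s)) * Y s
        + (g' (t - s) + lam * g (t - s)) * z s.toNNReal
        + (-g' (t - s) * X s
          + g (t - s) * (-(lam * y s.toNNReal) - lam * z s.toNNReal))) s := fun s ↦
    (((hg' s).add ((hg s).const_mul lam)).mul (hYd s)).add ((hg s).mul (hXd s))
  have hint : ∫ s in (0 : ℝ)..t, g' (t - s) * b s.toNNReal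
      = (g' (t - t) + lam * g (t - t)) * Y t + g (t - t) * X t
        - ((g' (t - 0) + lam * g (t - 0)) * Y 0 + g (t - 0) * X 0) := by
    refine intervalIntegral.integral_eq_sub_of_hasDerivAt
      (f := fun s ↦ (g' (t - s) + lam * g (t - s)) * Y s + g (t - s) * X s) (fun s hs ↦ ?_)
      (Continuous.intervalIntegrable (by
        have := h.continuous_deriv
        fun_prop) _ _)
    rw [Set.uIcc_of_le t.coe_nonneg] at hs
    refine (hΦ s).congr_deriv ?_
    rw [hXz s hs.1, hYy s hs.1]
    ring
  have hyt : y t = Y t := hyz t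
  have hb0 : X 0 = z 0 := by simp [hX]
  have hY0 : Y 0 = y 0 := by simp [hY]
  rw [hint, hyt, hb0, hY0, sub_self, sub_zero, h.zero, h.deriv_zero]
  ring

end IsImpulseResponse

/-! ### Second moments of time integrals of Brownian motion -/

variable {Ω : Type*} [MeasurableSpace Ω] {P : Measure Ω}

/-- A process with almost surely continuous paths is indistinguishable from a jointly measurable
one. -/
theorem exists_measurable_uncurry {B : ℝ≥0 → Ω → ℝ} (hm : ∀ t, AEMeasurable (B t) P)
    (hc : ∀ᵐ ω ∂P, Continuous fun t ↦ B t ω) :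
    ∃ B' : ℝ≥0 → Ω → ℝ, Measurable (Function.uncurry B') ∧ ∀ᵐ ω ∂P, ∀ t, B' t ω = B t ω := by
  classical
  let q : ℕ → ℝ≥0 := TopologicalSpace.denseSeq ℝ≥0
  have hgood : ∀ᵐ ω ∂P, (Continuous fun t ↦ B t ω) ∧ ∀ n, B (q n) ω = (hm (q n)).mk _ ω :=
    hc.and (ae_all_iff.2 fun n ↦ (hm (q n)).ae_eq_mk)
  obtain ⟨G, hGs, hGm, hG⟩ := hgood.exists_measurable_mem
  -- Zeroing the paths off `G` makes every path continuous. At the dense times `B'` is measurable,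
  -- and limits along them reach all times.
  let B' : ℝ≥0 → Ω → ℝ := fun t ↦ G.indicator (B t)
  have hcont : ∀ ω, Continuous fun t ↦ B' t ω := fun ω ↦ by
    by_cases h : ω ∈ G
    · simpa [B', h] using (hG ω h).1
    · simpa [B', h] using continuous_const
  have hmeas : ∀ t, Measurable (B' t) := fun t ↦ by
    have ht : t ∈ closure (Set.range q) := by
      rw [(TopologicalSpace.denseRange_denseSeq ℝ≥0).closure_range]; trivial
    obtain ⟨x, hx, hxt⟩ := mem_closure_iff_seq_limit.1 ht
    choose n hn using hx
    refine measurable_of_tendsto_metrizable (f := fun k ↦ B' (x k)) (fun k ↦ ?_)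
      (tendsto_pi_nhds.2 fun ω ↦ ((hcont ω).tendsto t).comp hxt)
    have : B' (x k) = G.indicator ((hm (q (n k))).mk _) := by
      ext ω
      by_cases h : ω ∈ G
      · simp only [B', Set.indicator_of_mem h, ← hn k]
        exact (hG ω h).2 _
      · simp [B', h]
    rw [this]
    exact (hm _).measurable_mk.indicator hGm
  refine ⟨B', ?_, ?_⟩
  · exact measurable_uncurry_of_continuous_of_measurable (u := B') hcont hmeas
  · filter_upwards [hGs] with ω hω t
    simp [B', hω]

/-- Second moments of time integrals of jointly measurable processes. -/
theorem integrable_integral_mul_integral [IsProbabilityMeasure P] {ν : Measure ℝ}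
    [IsFiniteMeasure ν] {X Y : ℝ → Ω → ℝ} {C : ℝ}
    (hX : Measurable (Function.uncurry X)) (hY : Measurable (Function.uncurry Y))
    (hX2 : ∀ s, MemLp (X s) 2 P) (hY2 : ∀ s, MemLp (Y s) 2 P)
    (hXC : ∀ᵐ s ∂ν, ∫ ω, X s ω ^ 2 ∂P ≤ C) (hYC : ∀ᵐ s ∂ν, ∫ ω, Y s ω ^ 2 ∂P ≤ C) :
    Integrable (fun ω ↦ (∫ s, X s ω ∂ν) * ∫ r, Y r ω ∂ν) P ∧
      ∫ ω, (∫ s, X s ω ∂ν) * ∫ r, Y r ω ∂ν ∂P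
        = ∫ p, ∫ ω, X p.1 ω * Y p.2 ω ∂P ∂(ν.prod ν) := by
  have hmeas : Measurable fun z : Ω × ℝ × ℝ ↦ X z.2.1 z.1 * Y z.2.2 z.1 :=
    (hX.comp (by fun_prop : Measurable fun z : Ω × ℝ × ℝ ↦ (z.2.1, z.1))).mul
      (hY.comp (by fun_prop : Measurable fun z : Ω × ℝ × ℝ ↦ (z.2.2, z.1)))
  have hint : Integrable (fun z : Ω × ℝ × ℝ ↦ X z.2.1 z.1 * Y z.2.2 z.1) (P.prod (ν.prod ν)) := by
    rw [integrable_prod_iff' hmeas.aestronglyMeasurable]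
    refine ⟨Eventually.of_forall fun p ↦ (hX2 p.1).integrable_mul (hY2 p.2), ?_⟩
    refine Integrable.of_bound
      (hmeas.norm.stronglyMeasurable.integral_prod_left'.aestronglyMeasurable) C ?_
    have h1 : ∀ᵐ p ∂(ν.prod ν), ∫ ω, X p.1 ω ^ 2 ∂P ≤ C :=
      Measure.quasiMeasurePreserving_fst.ae hXC
    have h2 : ∀ᵐ p ∂(ν.prod ν), ∫ ω, Y p.2 ω ^ 2 ∂P ≤ C :=
      Measure.quasiMeasurePreserving_snd.ae hYC
    filter_upwards [h1, h2] with p hp1 hp2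
    rw [Real.norm_of_nonneg (integral_nonneg fun _ ↦ norm_nonneg _)]
    calc ∫ ω, ‖X p.1 ω * Y p.2 ω‖ ∂P
        ≤ ∫ ω, (X p.1 ω ^ 2 / 2 + Y p.2 ω ^ 2 / 2) ∂P := by
          refine integral_mono ((hX2 p.1).integrable_mul (hY2 p.2)).norm
            (((hX2 p.1).integrable_sq.div_const 2).add ((hY2 p.2).integrable_sq.div_const 2))
            fun ω ↦ ?_
          simp only [Real.norm_eq_abs, abs_mul]
          nlinarith [sq_nonneg (|X p.1 ω| - |Y p.2 ω|), sq_abs (X p.1 ω), sq_abs (Y p.2 ω)]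
      _ ≤ C := by
          rw [integral_add ((hX2 p.1).integrable_sq.div_const 2)
            ((hY2 p.2).integrable_sq.div_const 2), integral_div, integral_div]
          linarith
  have hprod : ∀ ω, (∫ s, X s ω ∂ν) * ∫ r, Y r ω ∂ν
      = ∫ p, X p.1 ω * Y p.2 ω ∂(ν.prod ν) := fun ω ↦
    (integral_prod_mul (fun s ↦ X s ω) (fun r ↦ Y r ω)).symm
  simp_rw [hprod]
  exact ⟨hint.integral_prod_left, integral_integral_swap hint⟩

/-- The kernel `min s r` is the covariance of white noise integrated over `[0, s]` and `[0, r]`. -/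
theorem integral_integral_deriv_mul_min {k k' : ℝ → ℝ} (hk : ∀ s, HasDerivAt k (k' s) s)
    (hk' : Continuous k') {t : ℝ} (ht : 0 ≤ t) (hkt : k t = 0) :
    ∫ s in (0 : ℝ)..t, ∫ r in (0 : ℝ)..t, k' s * k' r * min s r = ∫ s in (0 : ℝ)..t, k s ^ 2 := by
  have hkc : Continuous k := continuous_iff_continuousAt.2 fun s ↦ (hk s).continuousAt
  set K : ℝ → ℝ := fun s ↦ ∫ r in (0 : ℝ)..s, k r with hK
  have hKd : ∀ s, HasDerivAt K (k s) s := fun s ↦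
    intervalIntegral.integral_hasDerivAt_right (hkc.intervalIntegrable _ _)
      (hkc.stronglyMeasurableAtFilter _ _) hkc.continuousAt
  have hKc : Continuous K := continuous_iff_continuousAt.2 fun s ↦ (hKd s).continuousAt
  -- Integration by parts in `r`, split at the kink `r = s`: the boundary terms at `s` cancel and
  -- the one at `t` vanishes because `k t = 0`.
  have hin : ∀ s ∈ Set.uIcc 0 t, ∫ r in (0 : ℝ)..t, k' s * k' r * min s r = -(k' s * K s) := by
    intro s hs
    rw [Set.uIcc_of_le ht] at hs
    have hc : Continuous fun r ↦ k' s * k' r * min s r := by fun_prop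
    rw [← intervalIntegral.integral_add_adjacent_intervals (hc.intervalIntegrable 0 s)
      (hc.intervalIntegrable s t)]
    have h1 : ∫ r in (0 : ℝ)..s, k' s * k' r * min s r = k' s * (k s * s) - k' s * K s := by
      have hd : ∀ r, HasDerivAt (fun r ↦ k' s * (k r * r) - k' s * K r) (k' s * k' r * r) r :=
        fun r ↦ ((((hk r).mul (hasDerivAt_id r)).const_mul _).sub
          ((hKd r).const_mul _)).congr_deriv (by simp; ring)
      rw [intervalIntegral.integral_congr (g := fun r ↦ k' s * k' r * r) (fun r hr ↦ ?_),
        intervalIntegral.integral_eq_sub_of_hasDerivAt (fun r _ ↦ hd r)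
          (Continuous.intervalIntegrable (by fun_prop) _ _)]
      · simp [hK]
      · rw [Set.uIcc_of_le hs.1] at hr
        simp [min_eq_right hr.2]
    have h2 : ∫ r in s..t, k' s * k' r * min s r = -(k' s * (k s * s)) := by
      have hd : ∀ r, HasDerivAt (fun r ↦ k' s * s * k r) (k' s * s * k' r) r :=
        fun r ↦ (hk r).const_mul _
      rw [intervalIntegral.integral_congr (g := fun r ↦ k' s * s * k' r) (fun r hr ↦ ?_),
        intervalIntegral.integral_eq_sub_of_hasDerivAt (fun r _ ↦ hd r)
          (Continuous.intervalIntegrable (by fun_prop) _ _), hkt]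
      · ring
      · rw [Set.uIcc_of_le hs.2] at hr
        simp only [min_eq_left hr.1]
        ring
    rw [h1, h2]; ring
  rw [intervalIntegral.integral_congr hin]
  -- A second integration by parts; `K 0 = 0` and `k t = 0` remove the boundary terms.
  have hd : ∀ s, HasDerivAt (fun s ↦ k s * K s) (k' s * K s + k s * k s) s := fun s ↦
    (hk s).mul (hKd s)
  have h := intervalIntegral.integral_eq_sub_of_hasDerivAt (a := 0) (b := t) (fun r _ ↦ hd r)
    (Continuous.intervalIntegrable (by fun_prop) _ _)
  rw [intervalIntegral.integral_add (Continuous.intervalIntegrable (by fun_prop) _ _)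
    (Continuous.intervalIntegrable (by fun_prop) _ _), hkt] at h
  have hK0 : K 0 = 0 := by simp [hK]
  rw [hK0, zero_mul, mul_zero, sub_zero] at h
  rw [intervalIntegral.integral_neg]
  simp_rw [pow_two]
  linarith

namespace IsStandardBrownian

variable {V : Type*} {W : V → ℝ≥0 → Ω → ℝ}

theorem integral_mul [DecidableEq V] (hW : IsStandardBrownian W P) (v w : V) (s r : ℝ≥0) :
    ∫ ω, W v s ω * W w r ω ∂P = if v = w then ((min s r : ℝ≥0) : ℝ) else 0 := by
  have hP : IsProbabilityMeasure P := ((hW.isBrownian v).hasLaw_eval 0).isProbabilityMeasure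
  have h2 : ∀ v s, MemLp (W v s) 2 P := fun v s ↦
    ((hW.isBrownian v).hasLaw_eval s).hasGaussianLaw.memLp_two
  have hcov : ∫ ω, W v s ω * W w r ω ∂P = cov[W v s, W w r; P] := by
    rw [covariance_eq_sub (h2 v s) (h2 w r), (hW.isBrownian v).integral_eval]
    simp
  rw [hcov]
  split_ifs with h
  · subst h
    exact (hW.isBrownian v).covariance_eval s r
  · have hi : IndepFun (W v s) (W w r) P :=
      (hW.indep.indepFun h).comp (measurable_pi_apply s) (measurable_pi_apply r)
    exact hi.covariance_eq_zero (h2 v s) (h2 w r)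

/-- The variance of the Wiener integral `-∑ v, ∫ k v dW v`, written as `∑ v, ∫ k' v W v ds`. -/
theorem memLp_sum_integral [Fintype V] [IsProbabilityMeasure P] (hW : IsStandardBrownian W P)
    {k k' : V → ℝ → ℝ} (hk : ∀ v s, HasDerivAt (k v) (k' v s) s)
    (hk' : ∀ v, Continuous (k' v)) {t : ℝ} (ht : 0 ≤ t) (hkt : ∀ v, k v t = 0) :
    MemLp (fun ω ↦ ∑ v, ∫ s in (0 : ℝ)..t, k' v s * W v s.toNNReal ω) 2 P ∧
      ∫ ω, (∑ v, ∫ s in (0 : ℝ)..t, k' v s * W v s.toNNReal ω) ^ 2 ∂P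
        = ∑ v, ∫ s in (0 : ℝ)..t, k v s ^ 2 := by
  classical
  -- Fubini requires joint measurability in time and `ω`, hence these modifications.
  choose B hBm hB using fun v ↦
    exists_measurable_uncurry (fun t ↦ (hW.isBrownian v).aemeasurable t) (hW.isBrownian v).cont
  have hB' : ∀ v s, B v s =ᵐ[P] W v s := fun v s ↦ (hB v).mono fun ω h ↦ h s
  set ν : Measure ℝ := volume.restrict (Set.Ioc 0 t) with hν
  let X : V → ℝ → Ω → ℝ := fun v s ω ↦ k' v s * B v s.toNNReal ω
  have hXm : ∀ v, Measurable (Function.uncurry (X v)) := fun v ↦ by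
    refine ((hk' v).measurable.comp measurable_fst).mul ((hBm v).comp
      (by fun_prop : Measurable fun z : ℝ × Ω ↦ (z.1.toNNReal, z.2)))
  have hX2 : ∀ v s, MemLp (X v s) 2 P := fun v s ↦
    ((memLp_congr_ae (hB' v s.toNNReal)).2
      ((hW.isBrownian v).hasLaw_eval _).hasGaussianLaw.memLp_two).const_mul _
  have hXX : ∀ v w s r, ∫ ω, X v s ω * X w r ω ∂P
      = k' v s * k' w r * if v = w then ((min s.toNNReal r.toNNReal : ℝ≥0) : ℝ) else 0 := by
    intro v w s r
    rw [← hW.integral_mul v w, ← integral_const_mul]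
    refine integral_congr_ae ?_
    filter_upwards [hB' v s.toNNReal, hB' w r.toNNReal] with ω h1 h2
    simp only [X, h1, h2]
    ring
  have hbd : ∀ v, ∃ C, ∀ s ∈ Set.Icc 0 t, ‖k' v s ^ 2 * s‖ ≤ C := fun v ↦
    isCompact_Icc.exists_bound_of_continuousOn (by fun_prop)
  choose C hC using hbd
  set D := ∑ v, |C v| with hD
  have hXC : ∀ v, ∀ᵐ s ∂ν, ∫ ω, X v s ω ^ 2 ∂P ≤ D := fun v ↦ by
    rw [hν]
    filter_upwards [ae_restrict_mem measurableSet_Ioc] with s hs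
    have h1 := hXX v v s s
    simp only [if_true, min_self, Real.coe_toNNReal s hs.1.le] at h1
    simp_rw [pow_two]
    rw [h1]
    have h2 := (Real.le_norm_self _).trans (hC v s ⟨hs.1.le, hs.2⟩)
    have h3 : |C v| ≤ D := Finset.single_le_sum (f := fun v ↦ |C v|) (fun _ _ ↦ abs_nonneg _)
      (Finset.mem_univ v)
    calc _ = k' v s ^ 2 * s := by ring
      _ ≤ _ := h2.trans ((le_abs_self _).trans h3)
  have key := fun v w ↦ integrable_integral_mul_integral (hXm v) (hXm w) (hX2 v) (hX2 w)
    (hXC v) (hXC w)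
  let S : V → Ω → ℝ := fun v ω ↦ ∫ s, X v s ω ∂ν
  have hS : ∀ v, Measurable (S v) := fun v ↦
    ((hXm v).comp measurable_swap).stronglyMeasurable.integral_prod_right'.measurable
  have hSS : ∀ v w, ∫ ω, S v ω * S w ω ∂P
      = if v = w then ∫ s in (0 : ℝ)..t, k v s ^ 2 else 0 := fun v w ↦ by
    rw [(key v w).2]
    simp_rw [hXX]
    split_ifs with h
    · subst h
      rw [← integral_integral_deriv_mul_min (hk v) (hk' v) ht (hkt v)]
      simp_rw [intervalIntegral.integral_of_le ht, ← hν]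
      have hc : Continuous fun p : ℝ × ℝ ↦
          k' v p.1 * k' v p.2 * (min p.1.toNNReal p.2.toNNReal : ℝ≥0) := by
        have := hk' v
        fun_prop
      rw [integral_prod]
      · refine setIntegral_congr_fun measurableSet_Ioc fun s hs ↦
          setIntegral_congr_fun measurableSet_Ioc fun r hr ↦ ?_
        simp [NNReal.coe_min, Real.coe_toNNReal _ hs.1.le, Real.coe_toNNReal _ hr.1.le]
      · rw [hν, Measure.prod_restrict, ← Measure.volume_eq_prod]
        exact (hc.continuousOn.integrableOn_compact (isCompact_Icc.prod isCompact_Icc)).mono_set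
          (Set.prod_mono Set.Ioc_subset_Icc_self Set.Ioc_subset_Icc_self)
    · simp
  have hae : (fun ω ↦ ∑ v, ∫ s in (0 : ℝ)..t, k' v s * W v s.toNNReal ω)
      =ᵐ[P] fun ω ↦ ∑ v, S v ω := by
    filter_upwards [ae_all_iff.2 hB] with ω hω
    simp only [S, X, intervalIntegral.integral_of_le ht, ← hν, hω]
  have hSL : ∀ v, MemLp (S v) 2 P := fun v ↦
    (memLp_two_iff_integrable_sq (hS v).aestronglyMeasurable).2 (by
      simpa only [pow_two] using (key v v).1)
  refine ⟨(memLp_congr_ae hae).2 (memLp_finsetSum _ fun v _ ↦ hSL v), ?_⟩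
  calc _ = ∫ ω, (∑ v, S v ω) ^ 2 ∂P := integral_congr_ae (hae.mono fun ω h ↦ by simp only [h])
    _ = ∫ ω, ∑ v, ∑ w, S v ω * S w ω ∂P := by simp_rw [pow_two, Finset.sum_mul_sum]
    _ = ∑ v, ∑ w, ∫ ω, S v ω * S w ω ∂P := by
      rw [integral_finsetSum _ fun v _ ↦ integrable_finsetSum _ fun w _ ↦ (key v w).1]
      exact Finset.sum_congr rfl fun v _ ↦ integral_finsetSum _ fun w _ ↦ (key v w).1
    _ = _ := by simp [hSS]

end IsStandardBrownian

/-! ### Limits of second moments -/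

/-- The process `X` is square integrable and its second moment tends to `h`. -/
structure HasLimitSecondMoment (X : ℝ≥0 → Ω → ℝ) (P : Measure Ω) (h : ℝ) : Prop where
  memLp : ∀ t, MemLp (X t) 2 P
  tendsto : Tendsto (fun t ↦ ∫ ω, X t ω ^ 2 ∂P) atTop (𝓝 h)

namespace HasLimitSecondMoment

theorem congr {X Y : ℝ≥0 → Ω → ℝ} {h : ℝ} (hX : HasLimitSecondMoment X P h)
    (hXY : ∀ t, X t =ᵐ[P] Y t) : HasLimitSecondMoment Y P h where
  memLp t := (memLp_congr_ae (hXY t)).1 (hX.memLp t)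
  tendsto := hX.tendsto.congr fun t ↦ integral_congr_ae ((hXY t).mono fun ω h ↦ by simp only [h])

theorem mul_of_tendsto_zero {A : Ω → ℝ} (hA : MemLp A 2 P) {f : ℝ≥0 → ℝ}
    (hf : Tendsto f atTop (𝓝 0)) : HasLimitSecondMoment (fun t ω ↦ f t * A ω) P 0 where
  memLp t := hA.const_mul _
  tendsto := by
    simp_rw [mul_pow, integral_const_mul]
    simpa using (hf.pow 2).mul_const (∫ ω, A ω ^ 2 ∂P)

/-- By Cauchy–Schwarz the cross term is at most the root of a product tending to `0 * h`. -/
theorem zero_add {X Y : ℝ≥0 → Ω → ℝ} {h : ℝ} (hX : HasLimitSecondMoment X P 0)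
    (hY : HasLimitSecondMoment Y P h) : HasLimitSecondMoment (fun t ω ↦ X t ω + Y t ω) P h where
  memLp t := (hX.memLp t).add (hY.memLp t)
  tendsto := by
    set m : ℝ≥0 → ℝ := fun t ↦ ∫ ω, X t ω * Y t ω ∂P with hm
    have hexp : ∀ t (c : ℝ), ∫ ω, (c * X t ω + Y t ω) ^ 2 ∂P
        = (∫ ω, X t ω ^ 2 ∂P) * (c * c) + 2 * m t * c + ∫ ω, Y t ω ^ 2 ∂P := fun t c ↦ by
      have h1 := (hX.memLp t).integrable_sq.mul_const (c * c)
      have h2 : Integrable (fun ω ↦ 2 * c * (X t ω * Y t ω)) P :=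
        ((hX.memLp t).integrable_mul (hY.memLp t)).const_mul (2 * c)
      rw [← integral_mul_const, show 2 * m t * c = 2 * c * m t by ring, hm,
        ← integral_const_mul, ← integral_add h1 h2, ← integral_add (by exact h1.add h2) (hY.memLp t).integrable_sq]
      congr 1 with ω
      ring
    have hle : ∀ t, m t ^ 2 ≤ (∫ ω, X t ω ^ 2 ∂P) * ∫ ω, Y t ω ^ 2 ∂P := fun t ↦ by
      -- The quadratic `c ↦ E (c X + Y)²` is nonnegative, so its discriminant is nonpositive.
      have := discrim_le_zero (fun c ↦ (hexp t c).symm ▸ integral_nonneg fun ω ↦ sq_nonneg _)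
      rw [discrim] at this
      linarith
    have hm0 : Tendsto m atTop (𝓝 0) := by
      rw [tendsto_zero_iff_abs_tendsto_zero]
      have h1 := (hX.tendsto.mul hY.tendsto).sqrt
      rw [zero_mul, Real.sqrt_zero] at h1
      exact squeeze_zero (fun t ↦ abs_nonneg _) (fun t ↦ Real.abs_le_sqrt (hle t)) h1
    have h1 := fun t ↦ hexp t 1
    simp only [one_mul, mul_one] at h1
    simp_rw [h1]
    simpa using (hX.tendsto.add (hm0.const_mul 2)).add hY.tendsto

end HasLimitSecondMoment

/-! ### Laplacian eigenmodes of a solution -/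

section Modes

variable {V : Type*} [Fintype V] [DecidableEq V] {G : SimpleGraph V} [DecidableRel G.Adj]
  {W : V → ℝ≥0 → Ω → ℝ} {x₁ x₂ : ℝ≥0 → Ω → V → ℝ}

theorem dotProduct_lapMatrix_mulVec {lam : ℝ} {a : V → ℝ}
    (ha : G.lapMatrix ℝ *ᵥ a = lam • a) (x : V → ℝ) :
    a ⬝ᵥ G.lapMatrix ℝ *ᵥ x = lam * a ⬝ᵥ x := by
  rw [Matrix.dotProduct_mulVec, ← Matrix.mulVec_transpose, (G.isSymm_lapMatrix ℝ).eq, ha,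
    smul_dotProduct, smul_eq_mul]

namespace IsSolution

/-- The component of a solution along an eigenvector of the Laplacian matrix. -/
theorem dotProduct_eq (hx : IsSolution G W x₁ x₂ P) {lam : ℝ} {a : V → ℝ}
    (ha : G.lapMatrix ℝ *ᵥ a = lam • a) {g g' : ℝ → ℝ} (h : IsImpulseResponse lam g g') :
    ∀ᵐ ω ∂P, ∀ t : ℝ≥0, a ⬝ᵥ x₁ t ω = (g' t + lam * g t) * a ⬝ᵥ x₁ 0 ω + g t * a ⬝ᵥ x₂ 0 ω
      + ∑ v, ∫ s in (0 : ℝ)..t, a v * g' (t - s) * W v s.toNNReal ω := by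
  filter_upwards [hx.continuous_fst, hx.continuous_snd, hx.eq_fst, hx.eq_snd,
    ae_all_iff.2 fun v ↦ (hx.isStandardBrownian.isBrownian v).cont] with ω h1 h2 e1 e2 hW t
  have c1 : Continuous fun s : ℝ ↦ x₁ s.toNNReal ω := h1.comp continuous_real_toNNReal
  have c2 : Continuous fun s : ℝ ↦ x₂ s.toNNReal ω := h2.comp continuous_real_toNNReal
  have cW : ∀ v, Continuous fun s : ℝ ↦ W v s.toNNReal ω := fun v ↦
    (hW v).comp continuous_real_toNNReal
  have cdot : ∀ {T : Type} [TopologicalSpace T] {x : T → V → ℝ}, Continuous x →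
      Continuous fun t ↦ a ⬝ᵥ x t := fun hx ↦ continuous_const.dotProduct hx
  have cL : ∀ {x : ℝ → V → ℝ}, Continuous x → ∀ v, Continuous fun s ↦ (G.lapMatrix ℝ *ᵥ x s) v :=
    fun hx v ↦ (continuous_apply v).comp (continuous_const.matrix_mulVec hx)
  have key := h.eq_of_integral_eq (y := fun t ↦ a ⬝ᵥ x₁ t ω) (z := fun t ↦ a ⬝ᵥ x₂ t ω)
    (b := fun t ↦ a ⬝ᵥ fun v ↦ W v t ω) (cdot h1) (cdot h2) (cdot (continuous_pi hW))
    (fun t ↦ ?_) (fun t ↦ ?_) t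
  · rw [key]
    congr 1
    rw [← intervalIntegral.integral_finsetSum fun v _ ↦ Continuous.intervalIntegrable
      (by have := h.continuous_deriv; have := cW v; fun_prop) _ _]
    simp_rw [dotProduct, Finset.mul_sum]
    refine intervalIntegral.integral_congr fun s _ ↦ Finset.sum_congr rfl fun v _ ↦ by ring
  · simp only [dotProduct]
    rw [intervalIntegral.integral_finsetSum fun v _ ↦ Continuous.intervalIntegrable
      (by fun_prop) _ _, ← Finset.sum_add_distrib]
    refine Finset.sum_congr rfl fun v _ ↦ ?_
    rw [intervalIntegral.integral_const_mul, e1 t v]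
    ring
  · simp_rw [← dotProduct_lapMatrix_mulVec ha, ← dotProduct_neg, ← dotProduct_sub]
    simp only [dotProduct]
    rw [intervalIntegral.integral_finsetSum fun v _ ↦ Continuous.intervalIntegrable
      (by have := cL c1 v; have := cL c2 v; simp only [Pi.sub_apply, Pi.neg_apply]; fun_prop) _ _,
      ← Finset.sum_add_distrib, ← Finset.sum_add_distrib]
    refine Finset.sum_congr rfl fun v _ ↦ ?_
    rw [intervalIntegral.integral_const_mul, e2 t v]
    simp only [Pi.sub_apply, Pi.neg_apply]
    ring

theorem memLp_dotProduct_init (hx : IsSolution G W x₁ x₂ P) (a : V → ℝ) :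
    MemLp (fun ω ↦ a ⬝ᵥ x₁ 0 ω) 2 P ∧ MemLp (fun ω ↦ a ⬝ᵥ x₂ 0 ω) 2 P :=
  ⟨memLp_finsetSum _ fun v _ ↦ (hx.memLp_init_fst v).const_mul (a v),
    memLp_finsetSum _ fun v _ ↦ (hx.memLp_init_snd v).const_mul (a v)⟩

/-- The limiting second moment of a solution along the sum of two orthogonal eigenvectors of the
Laplacian matrix. -/
theorem hasLimitSecondMoment [IsProbabilityMeasure P] (hx : IsSolution G W x₁ x₂ P)
    {lam mu : ℝ} (hlam : 0 < lam) (hmu : 0 < mu) {a d : V → ℝ}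
    (ha : G.lapMatrix ℝ *ᵥ a = lam • a) (hd : G.lapMatrix ℝ *ᵥ d = mu • d) (had : a ⬝ᵥ d = 0) :
    HasLimitSecondMoment (fun t ω ↦ (a + d) ⬝ᵥ x₁ t ω) P
      (a ⬝ᵥ a * (1 / (2 * lam ^ 2)) + d ⬝ᵥ d * (1 / (2 * mu ^ 2))) := by
  obtain ⟨g, g', hg⟩ := exists_isImpulseResponse lam
  obtain ⟨f, f', hf⟩ := exists_isImpulseResponse mu
  have cg' := hg.continuous_deriv
  have cf' := hf.continuous_deriv
  have cg := hg.continuous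
  have cf := hf.continuous
  have hcoe : Tendsto (fun t : ℝ≥0 ↦ (t : ℝ)) atTop atTop := NNReal.tendsto_coe_atTop.2 tendsto_id
  have init : ∀ {lam : ℝ} {g g' : ℝ → ℝ}, IsImpulseResponse lam g g' → 0 < lam → ∀ a : V → ℝ,
      HasLimitSecondMoment (fun t ω ↦ (g' t + lam * g t) * a ⬝ᵥ x₁ 0 ω + g t * a ⬝ᵥ x₂ 0 ω) P 0 := by
    intro lam g g' hg hlam a
    have h1 := (hg.tendsto_zero hlam).comp hcoe
    have h2 := (hg.tendsto_deriv_zero hlam).comp hcoe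
    refine (HasLimitSecondMoment.mul_of_tendsto_zero (hx.memLp_dotProduct_init a).1 ?_).zero_add
      (HasLimitSecondMoment.mul_of_tendsto_zero (hx.memLp_dotProduct_init a).2 h1)
    simpa using h2.add (h1.const_mul lam)
  have noise : HasLimitSecondMoment (fun t ω ↦ ∑ v, ∫ s in (0 : ℝ)..t,
      (a v * g' (t - s) + d v * f' (t - s)) * W v s.toNNReal ω) P
      (a ⬝ᵥ a * (1 / (2 * lam ^ 2)) + d ⬝ᵥ d * (1 / (2 * mu ^ 2))) := by
    -- Both modes are driven by the same `W`, so their kernels are combined vertex by vertex; the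
    -- result vanishes at `s = t` since `g 0 = f 0 = 0`.
    have key := fun t : ℝ≥0 ↦ hx.isStandardBrownian.memLp_sum_integral
      (k := fun v s ↦ -(a v * g (t - s) + d v * f (t - s)))
      (k' := fun v s ↦ a v * g' (t - s) + d v * f' (t - s))
      (fun v s ↦ by
        have hsub : HasDerivAt (fun s ↦ (t : ℝ) - s) (-1) s := by
          simpa using (hasDerivAt_id s).const_sub (t : ℝ)
        exact ((((hg.hasDerivAt (t - s)).comp s hsub).const_mul (a v)).add
          (((hf.hasDerivAt (t - s)).comp s hsub).const_mul (d v))).neg.congr_deriv (by ring))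
      (fun v ↦ by fun_prop) t.coe_nonneg (fun v ↦ by simp [hg.zero, hf.zero])
    refine ⟨fun t ↦ (key t).1, ?_⟩
    simp_rw [fun t ↦ (key t).2]
    have hval : ∀ t : ℝ≥0,
        ∑ v, ∫ s in (0 : ℝ)..t, (-(a v * g (t - s) + d v * f (t - s))) ^ 2
          = a ⬝ᵥ a * (∫ s in (0 : ℝ)..t, g s ^ 2) + d ⬝ᵥ d * ∫ s in (0 : ℝ)..t, f s ^ 2 := by
      intro t
      -- Orthogonality of `a` and `d` removes the correlation between the modes.
      have hpt : ∀ s : ℝ, ∑ v, (-(a v * g (t - s) + d v * f (t - s))) ^ 2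
          = a ⬝ᵥ a * g (t - s) ^ 2 + d ⬝ᵥ d * f (t - s) ^ 2 := fun s ↦ by
        have : ∑ v, (-(a v * g (t - s) + d v * f (t - s))) ^ 2
          = a ⬝ᵥ a * g (t - s) ^ 2 + d ⬝ᵥ d * f (t - s) ^ 2
            + a ⬝ᵥ d * (2 * g (t - s) * f (t - s)) := by
          simp only [dotProduct, Finset.sum_mul, ← Finset.sum_add_distrib]
          exact Finset.sum_congr rfl fun v _ ↦ by ring
        rw [this, had]; ring
      rw [← intervalIntegral.integral_finsetSum fun v _ ↦ Continuous.intervalIntegrable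
        (by fun_prop) _ _]
      simp_rw [hpt]
      rw [intervalIntegral.integral_add (Continuous.intervalIntegrable (by fun_prop) _ _)
        (Continuous.intervalIntegrable (by fun_prop) _ _), intervalIntegral.integral_const_mul,
        intervalIntegral.integral_const_mul,
        intervalIntegral.integral_comp_sub_left (fun s ↦ g s ^ 2),
        intervalIntegral.integral_comp_sub_left (fun s ↦ f s ^ 2), sub_self, sub_zero]
    simp_rw [hval]
    exact (((hg.tendsto_integral_sq hlam).comp hcoe).const_mul _).add
      (((hf.tendsto_integral_sq hmu).comp hcoe).const_mul _)
  refine ((init hg hlam a).zero_add ((init hf hmu d).zero_add noise)).congr fun t ↦ ?_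
  filter_upwards [hx.dotProduct_eq ha hg, hx.dotProduct_eq hd hf,
    ae_all_iff.2 fun v ↦ (hx.isStandardBrownian.isBrownian v).cont] with ω h1 h2 hW
  have cW : ∀ v, Continuous fun s : ℝ ↦ W v s.toNNReal ω := fun v ↦
    (hW v).comp continuous_real_toNNReal
  have hsum : ∑ v, ∫ s in (0 : ℝ)..t, (a v * g' (t - s) + d v * f' (t - s)) * W v s.toNNReal ω
      = (∑ v, ∫ s in (0 : ℝ)..t, a v * g' (t - s) * W v s.toNNReal ω)
        + ∑ v, ∫ s in (0 : ℝ)..t, d v * f' (t - s) * W v s.toNNReal ω := by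
    rw [← Finset.sum_add_distrib]
    refine Finset.sum_congr rfl fun v _ ↦ ?_
    have := cW v
    rw [← intervalIntegral.integral_add (Continuous.intervalIntegrable (by fun_prop) _ _)
      (Continuous.intervalIntegrable (by fun_prop) _ _)]
    simp_rw [add_mul]
  rw [hsum, add_dotProduct, h1 t, h2 t]
  ring

end IsSolution

theorem HasLimitSecondMoment.hasPairwiseVariance {j k : V} {h : ℝ}
    (hl : HasLimitSecondMoment
      (fun t ω ↦ (Pi.single j 1 - Pi.single k 1 : V → ℝ) ⬝ᵥ x₁ t ω) P h) :
    HasPairwiseVariance x₁ P j k h := by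
  simp only [sub_dotProduct, single_one_dotProduct] at hl
  exact ⟨fun t ↦ (hl.memLp t).integrable_sq, hl.tendsto⟩

theorem HasLimitSecondMoment.hasVertexVariance {j : V} {h : ℝ}
    (hl : HasLimitSecondMoment
      (fun t ω ↦ (Pi.single j 1 - fun _ ↦ 1 / (Fintype.card V : ℝ) : V → ℝ) ⬝ᵥ x₁ t ω) P h) :
    HasVertexVariance x₁ P j h := by
  have : ∀ x : V → ℝ, (Pi.single j 1 - fun _ ↦ 1 / (Fintype.card V : ℝ) : V → ℝ) ⬝ᵥ x
      = x j - average x := fun x ↦ by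
    rw [sub_dotProduct, single_one_dotProduct]
    simp [dotProduct, average, Finset.mul_sum, div_eq_inv_mul]
  simp only [this] at hl
  exact ⟨fun t ↦ (hl.memLp t).integrable_sq, hl.tendsto⟩

end Modes

/-! ### The star graph -/

section Star

variable {N : ℕ} [NeZero N]

theorem lapMatrix_starGraph_mulVec_zero (x : Fin N → ℝ) :
    ((SimpleGraph.starGraph (0 : Fin N)).lapMatrix ℝ *ᵥ x) 0 = N * x 0 - ∑ v, x v := by
  rw [SimpleGraph.lapMatrix_mulVec_apply, SimpleGraph.degree]
  have : (SimpleGraph.starGraph (0 : Fin N)).neighborFinset 0 = Finset.univ.erase 0 := by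
    ext v; simp [eq_comm]
  rw [this, Finset.card_erase_of_mem (Finset.mem_univ _), Finset.card_univ, Fintype.card_fin,
    ← Finset.add_sum_erase _ x (Finset.mem_univ 0), Nat.cast_pred (NeZero.pos N)]
  ring

theorem lapMatrix_starGraph_mulVec_of_ne (x : Fin N → ℝ) {j : Fin N} (hj : j ≠ 0) :
    ((SimpleGraph.starGraph (0 : Fin N)).lapMatrix ℝ *ᵥ x) j = x j - x 0 := by
  rw [SimpleGraph.lapMatrix_mulVec_apply, SimpleGraph.degree]
  have : (SimpleGraph.starGraph (0 : Fin N)).neighborFinset j = {0} := by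
    ext v
    simp only [SimpleGraph.mem_neighborFinset, SimpleGraph.starGraph_adj, Finset.mem_singleton]
    grind
  rw [this]
  simp

variable [IsProbabilityMeasure P] {W : Fin N → ℝ≥0 → Ω → ℝ}
  {x₁ x₂ : ℝ≥0 → Ω → Fin N → ℝ}

/-- `c` splits orthogonally as `a + d`: `a` is the multiple of `(N - 1, -1, …, -1)` that matches `c`
at the hub, with eigenvalue `N`, and `d` vanishes at the hub and sums to zero, with eigenvalue `1`.
Only `c ⬝ᵥ c` and `c 0` then enter, through `a ⬝ᵥ a = α * N * c 0`. -/
theorem IsSolution.hasLimitSecondMoment_starGraph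
    (hx : IsSolution (SimpleGraph.starGraph (0 : Fin N)) W x₁ x₂ P) {c : Fin N → ℝ}
    (hc : ∑ v, c v = 0) :
    HasLimitSecondMoment (fun t ω ↦ c ⬝ᵥ x₁ t ω) P
      ((c ⬝ᵥ c - c 0 ^ 2 * ((N + 1) / N)) / 2) := by
  have hN : 0 < (N : ℝ) := Nat.cast_pos.2 (NeZero.pos N)
  set α := c 0 / (N - 1) with hα
  -- For `N = 1` the quotient `α` is a division by zero, but then `c 0 = 0` by `hc`.
  have hαc : α * (N - 1) = c 0 := by
    rcases eq_or_ne (N : ℝ) 1 with h | h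
    · obtain rfl : N = 1 := by exact_mod_cast h
      simp only [Finset.univ_unique, Fin.default_eq_zero, Finset.sum_singleton] at hc
      simp [hc]
    · rw [hα, div_mul_cancel₀ _ (sub_ne_zero.2 h)]
  let u : Fin N → ℝ := fun v ↦ if v = 0 then (N : ℝ) - 1 else -1
  have hu : ∀ v, u v = (if v = 0 then (N : ℝ) else 0) - 1 := fun v ↦ by
    by_cases h : v = 0 <;> simp [u, h]
  have husum : ∑ v, u v = 0 := by simp [hu]
  have hudot : ∀ x : Fin N → ℝ, u ⬝ᵥ x = N * x 0 - ∑ v, x v := fun x ↦ by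
    simp [dotProduct, hu, sub_mul]
  have hu0 : u 0 = N - 1 := by simp [u]
  set a := α • u with ha
  set d := c - a with hd
  have hd0 : d 0 = 0 := by simp [hd, ha, hu0, hαc]
  have hdsum : ∑ v, d v = 0 := by
    simp [hd, ha, hc, ← Finset.mul_sum, husum]
  have hLa : (SimpleGraph.starGraph (0 : Fin N)).lapMatrix ℝ *ᵥ a = (N : ℝ) • a := by
    rw [ha, Matrix.mulVec_smul, smul_comm]
    congr 1
    ext j
    by_cases hj : j = 0
    · subst hj
      rw [lapMatrix_starGraph_mulVec_zero, husum]; simp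
    · rw [lapMatrix_starGraph_mulVec_of_ne _ hj]; simp [u, hj]; ring
  have hLd : (SimpleGraph.starGraph (0 : Fin N)).lapMatrix ℝ *ᵥ d = (1 : ℝ) • d := by
    ext j
    by_cases hj : j = 0
    · subst hj
      rw [lapMatrix_starGraph_mulVec_zero, hdsum]; simp [hd0]
    · rw [lapMatrix_starGraph_mulVec_of_ne _ hj]; simp [hd0]
  have had : a ⬝ᵥ d = 0 := by rw [ha, smul_dotProduct, hudot, hd0, hdsum]; simp
  have haa : a ⬝ᵥ a = α * (N * c 0) := by
    rw [ha, smul_dotProduct, dotProduct_smul, hudot, husum, hu0, smul_eq_mul, smul_eq_mul,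
      ← hαc]
    ring
  have hcad : c = a + d := by simp [hd]
  have hcc : c ⬝ᵥ c = a ⬝ᵥ a + d ⬝ᵥ d := by
    rw [hcad, add_dotProduct, dotProduct_add, dotProduct_add, had, dotProduct_comm d a, had]
    ring
  have key := hx.hasLimitSecondMoment hN one_pos hLa hLd had
  rw [← hcad] at key
  convert key using 1
  rw [eq_sub_of_add_eq' hcc.symm, haa, ← hαc]
  field_simp
  ring

theorem IsSolution.hasPairwiseVariance_starGraph
    (hx : IsSolution (SimpleGraph.starGraph (0 : Fin N)) W x₁ x₂ P) {j k : Fin N} (hjk : j ≠ k) :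
    HasPairwiseVariance x₁ P j k
      (1 - ((if j = 0 then 1 else 0) - if k = 0 then 1 else 0) ^ 2 * ((N + 1) / N) / 2) := by
  refine HasLimitSecondMoment.hasPairwiseVariance ?_
  convert hx.hasLimitSecondMoment_starGraph (c := Pi.single j 1 - Pi.single k 1) (by simp) using 1
  simp [Pi.single_apply, hjk, hjk.symm, eq_comm (a := (0 : Fin N))]
  ring

theorem IsSolution.hasVertexVariance_starGraph
    (hx : IsSolution (SimpleGraph.starGraph (0 : Fin N)) W x₁ x₂ P) (j : Fin N) :
    HasVertexVariance x₁ P j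
      ((1 - 1 / N - ((if j = 0 then 1 else 0) - 1 / N) ^ 2 * ((N + 1) / N)) / 2) := by
  have hN : (N : ℝ) ≠ 0 := Nat.cast_ne_zero.2 (NeZero.ne N)
  refine HasLimitSecondMoment.hasVertexVariance ?_
  rw [Fintype.card_fin]
  convert hx.hasLimitSecondMoment_starGraph (c := Pi.single j 1 - fun _ ↦ 1 / (N : ℝ))
    (by simp [hN]) using 1
  have : (Pi.single j 1 - fun _ ↦ 1 / (N : ℝ) : Fin N → ℝ) ⬝ᵥ
      (Pi.single j 1 - fun _ ↦ 1 / (N : ℝ)) = 1 - 1 / N := by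
    rw [sub_dotProduct, single_one_dotProduct]
    have : (fun _ ↦ 1 / (N : ℝ) : Fin N → ℝ) ⬝ᵥ (Pi.single j 1 - fun _ ↦ 1 / (N : ℝ)) = 0 := by
      simp [dotProduct, ← Finset.mul_sum, hN]
    rw [this]
    simp
  rw [this]
  simp [Pi.single_apply, eq_comm (a := (0 : Fin N))]

end Star

end SecondOrderConsensus

/-! ### Evaluation of the variances -/

theorem mainTheorem11 {Ω : Type*} [MeasurableSpace Ω] (P : Measure Ω) [IsProbabilityMeasure P]
    (N : ℕ) [NeZero N]
    (W : Fin N → ℝ≥0 → Ω → ℝ) (x₁ x₂ : ℝ≥0 → Ω → Fin N → ℝ)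
    (hx : SecondOrderConsensus.IsSolution
      (SimpleGraph.starGraph (0 : Fin N)) W x₁ x₂ P) :
    (∀ j : Fin N, j ≠ 0 →
      SecondOrderConsensus.HasPairwiseVariance x₁ P 0 j (((N : ℝ) - 1) / (2 * (N : ℝ)))) ∧
    (∀ j k : Fin N, j ≠ k → j ≠ 0 → k ≠ 0 →
      SecondOrderConsensus.HasPairwiseVariance x₁ P j k 1) ∧
    SecondOrderConsensus.HasVertexVariance x₁ P 0 (((N : ℝ) - 1) / (2 * (N : ℝ) ^ 3)) ∧
    (∀ j : Fin N, j ≠ 0 →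
      SecondOrderConsensus.HasVertexVariance x₁ P j
        (((N : ℝ) ^ 3 - (N : ℝ) ^ 2 - (N : ℝ) - 1) / (2 * (N : ℝ) ^ 3))) ∧
    SecondOrderConsensus.HasTotalVariance x₁ P
      ((N : ℝ) / 2 - 1 + 1 / (2 * (N : ℝ) ^ 2)) := by
  have hN : (N : ℝ) ≠ 0 := Nat.cast_ne_zero.2 (NeZero.ne N)
  have h0 : SecondOrderConsensus.HasVertexVariance x₁ P 0 (((N : ℝ) - 1) / (2 * (N : ℝ) ^ 3)) := by
    convert hx.hasVertexVariance_starGraph 0 using 1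
    simp only [if_true]
    field_simp
    ring
  have h1 : ∀ j : Fin N, j ≠ 0 → SecondOrderConsensus.HasVertexVariance x₁ P j
      (((N : ℝ) ^ 3 - (N : ℝ) ^ 2 - (N : ℝ) - 1) / (2 * (N : ℝ) ^ 3)) := fun j hj ↦ by
    convert hx.hasVertexVariance_starGraph j using 1
    simp only [hj, if_false]
    field_simp
    ring
  refine ⟨fun j hj ↦ ?_, fun j k hjk hj hk ↦ ?_, h0, h1, fun j t ↦ ?_, ?_⟩
  · convert hx.hasPairwiseVariance_starGraph hj.symm using 1
    simp only [hj, if_true, if_false]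
    field_simp
    ring
  · convert hx.hasPairwiseVariance_starGraph hjk using 1
    simp [hj, hk]
  · exact (hx.hasVertexVariance_starGraph j).1 t
  · have := tendsto_finsetSum Finset.univ fun j _ ↦ (hx.hasVertexVariance_starGraph j).2
    convert this using 2
    -- The total is the hub term plus `N - 1` equal leaf terms.
    rw [← Finset.add_sum_erase _ _ (Finset.mem_univ 0), Finset.sum_congr rfl
      (g := fun _ ↦ ((N : ℝ) ^ 3 - (N : ℝ) ^ 2 - (N : ℝ) - 1) / (2 * (N : ℝ) ^ 3))
      fun j hj ↦ ?_]
    · rw [Finset.sum_const, Finset.card_erase_of_mem (Finset.mem_univ _), Finset.card_univ,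
        Fintype.card_fin, nsmul_eq_mul, Nat.cast_pred (NeZero.pos N)]
      simp only [if_true]
      field_simp
      ring
    · simp only [Finset.ne_of_mem_erase hj, if_false]
      field_simp
      ring
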